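/- Let $n\ge 1$ and $0<\alpha<2$, and let $p_t(x,y)$, $t>0$, $x,y\in\mathbb R^n$, be the (continuous in $y$) transition probability density of a symmetric $\alpha$-stable process in $\mathbb R^n$, that is, of the process $X$ with stationary independent increments and $X_0=0$ such that $\mathbb E\, e^{i\xi\cdot X_t}=e^{-t\|\xi\|^\alpha}$; so $p_t(x,\cdot)$ is the density of $x+X_t$. Let $\varpi=\varpi^+-\varpi^-$ be a signed Borel measure on $\mathbb R^n$, given by mutually singular positive Borel measures $\varpi^\pm$ (not necessarily finite; $\varpi^-=0$ is the case of a positive measure), and let $|\varpi|=\varpi^++\varpi^-$. Say that $\varpi$ belongs to the Kato class $S_K$ with respect to $p$ if $$\lim_{t\to0+}\ \sup_{x\in\mathbb R^n}\int_0^t\int_{\mathbb R^n}p_s(x,y)\,\varpi^{\pm}(dy)\,ds=0$$ for both signs, and that $\varpi\in\mathcal K_{n,\alpha}$ if $$\lim_{t\to0+}\ \sup_{x\in\mathbb R^n}\int_0^t\frac{|\varpi|\{y:\ \|x-y\|\le s\}}{s^{\,n+1-\alpha}}\,ds=0.$$ Then $\varpi$ belongs to $S_K$ with respect to $p$ if and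 only if $\varpi\in\mathcal K_{n,\alpha}$. -/

import Mathlib

open MeasureTheory ProbabilityTheory Filter Topology
open scoped NNReal ENNReal

/-- A signed Borel measure `ϖ = ϖ⁺ - ϖ⁻` on `ℝⁿ`, given by its positive and negative parts, which
are mutually singular positive Borel measures. The parts may be infinite. A positive Borel measure
is the case `neg = 0`; a finite signed measure is represented by its Jordan decomposition. -/
structure SignedBorelMeasure (n : ℕ) where
  /-- the positive part `ϖ⁺` -/
  pos : Measure (EuclideanSpace ℝ (Fin n))
  /-- the negative part `ϖ⁻` -/
  neg : Measure (EuclideanSpace ℝ (Fin n))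
  mutuallySingular : pos ⟂ₘ neg

/-- The total variation `|ϖ| = ϖ⁺ + ϖ⁻`. -/
noncomputable def SignedBorelMeasure.totalVariation {n : ℕ} (ϖ : SignedBorelMeasure n) :
    Measure (EuclideanSpace ℝ (Fin n)) :=
  ϖ.pos + ϖ.neg

/-- `X` is a (rotationally) symmetric `α`-stable process in `ℝⁿ` under `P`, started at `0`:
it has independent increments, and the increment over a time interval of length `t` has
characteristic function `ξ ↦ exp (-t ‖ξ‖ ^ α)`. No regularity of the paths is required, so
versions with càdlàg paths are a special case. -/
structure IsSymmetricStableProcess {Ω : Type*} [MeasurableSpace Ω] {n : ℕ} (α : ℝ)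
    (X : ℝ≥0 → Ω → EuclideanSpace ℝ (Fin n)) (P : Measure Ω) : Prop where
  measurable : ∀ t, Measurable (X t)
  start_zero : ∀ᵐ ω ∂P, X 0 ω = 0
  indep_increments : HasIndepIncrements X P
  charFun_increment : ∀ (s t : ℝ≥0) (ξ : EuclideanSpace ℝ (Fin n)),
    charFun (P.map (fun ω => X (s + t) ω - X s ω)) ξ = Complex.exp (-((t : ℝ) * ‖ξ‖ ^ α : ℝ))

/-- `p t x y` is the transition probability density of the process with stationary independent
increments `X`: for `t > 0`, the function `p t x` is a nonnegative density of the law of `x + X t`,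
that is, of the position at time `t` of the process started at `x`. As usual, the version which is
continuous in `y` is meant; it is unique. -/
structure IsTransitionDensity {Ω : Type*} [MeasurableSpace Ω] {n : ℕ}
    (X : ℝ≥0 → Ω → EuclideanSpace ℝ (Fin n)) (P : Measure Ω)
    (p : ℝ → EuclideanSpace ℝ (Fin n) → EuclideanSpace ℝ (Fin n) → ℝ) : Prop where
  nonneg : ∀ t : ℝ, 0 < t → ∀ x y, 0 ≤ p t x y
  continuous : ∀ t : ℝ, 0 < t → ∀ x, Continuous (p t x)
  map_eq : ∀ t : ℝ≥0, 0 < t → ∀ x,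
    P.map (fun ω => x + X t ω) = volume.withDensity (fun y => ENNReal.ofReal (p t x y))

/-- The positive Borel measure `ϖ` is in the Kato class `S_K` with respect to `p`:
`sup_x ∫₀ᵗ ∫ p_s(x,y) ϖ(dy) ds → 0` as `t → 0+`. -/
def IsKatoPos {n : ℕ} (p : ℝ → EuclideanSpace ℝ (Fin n) → EuclideanSpace ℝ (Fin n) → ℝ)
    (ϖ : Measure (EuclideanSpace ℝ (Fin n))) : Prop :=
  Tendsto
    (fun t : ℝ => ⨆ x : EuclideanSpace ℝ (Fin n),
      ∫⁻ s in Set.Ioc 0 t, ∫⁻ y, ENNReal.ofReal (p s x y) ∂ϖ)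
    (𝓝[>] 0) (𝓝 0)

/-- The signed Borel measure `ϖ` is in the Kato class `S_K` with respect to `p`:
both `ϖ⁺` and `ϖ⁻` are. -/
def IsKato {n : ℕ} (p : ℝ → EuclideanSpace ℝ (Fin n) → EuclideanSpace ℝ (Fin n) → ℝ)
    (ϖ : SignedBorelMeasure n) : Prop :=
  IsKatoPos p ϖ.pos ∧ IsKatoPos p ϖ.neg

/-- The class `𝒦_{n,α}` of signed Borel measures `ϖ` on `ℝⁿ` with
`sup_x ∫₀ᵗ |ϖ|{y : ‖x - y‖ ≤ s} / s ^ (n + 1 - α) ds → 0` as `t → 0+`. -/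
def stableKatoClass (n : ℕ) (α : ℝ) : Set (SignedBorelMeasure n) :=
  {ϖ | Tendsto
    (fun t : ℝ => ⨆ x : EuclideanSpace ℝ (Fin n),
      ∫⁻ s in Set.Ioc 0 t,
        ϖ.totalVariation {y | ‖x - y‖ ≤ s} / ENNReal.ofReal (s ^ ((n : ℝ) + 1 - α)))
    (𝓝[>] 0) (𝓝 0)}

/-! By homogeneity and rotation invariance of the characteristic exponent, `p t x y = t^(-n/α)
g(t^(-1/α) ‖y - x‖)` for one continuous profile `g` (`IsTransitionDensity.exists_radial_profile`).
Fourier inversion gives `g 0 > 0`, and a characteristic function estimate gives `∫_V^∞ v^(n-1) g(v)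
dv ≤ C V^(-α)`. Nothing else about the process is used; in particular no pointwise decay of `g` is
needed.

The substitution `s = r^α` turns the heat potential up to time `T^α` into `α ∫_0^T r^(α-n-1) ∫ g(‖y
- x‖/r) μ(dy) dr`, to be compared with the same integral having ball masses inside. Since `g ≥
g(0)/2` near `0`, the potential dominates the ball integral (`exists_stableKatoModulus_le`).

Conversely (`exists_heatKatoModulus_le`), the radii `r ≥ ‖y - x‖` give ball masses because `g` is
bounded on `[0, 1]`. The radii `r < ‖y - x‖` are controlled by the integrated tail: points within
`T` of `x` are absorbed by doubling the range of radii, and distant points carry the weight `(1 + ‖y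
- x‖/T)^(-(n+α))`, whose integral is bounded by the largest mass of a ball of radius `T`. -/

/-! ### Densities, similarities and an integrability criterion -/

theorem eq_of_withDensity_ofReal_eq {E : Type*} [TopologicalSpace E] [MeasurableSpace E]
    [BorelSpace E] {μ : Measure E} [SigmaFinite μ] [μ.IsOpenPosMeasure] {f g : E → ℝ}
    (hf : Continuous f) (hg : Continuous g) (hf0 : ∀ x, 0 ≤ f x) (hg0 : ∀ x, 0 ≤ g x)
    (h : μ.withDensity (fun x => ENNReal.ofReal (f x)) =
      μ.withDensity (fun x => ENNReal.ofReal (g x))) : f = g := by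
  rw [withDensity_eq_iff_of_sigmaFinite (by fun_prop) (by fun_prop)] at h
  refine (hf.ae_eq_iff_eq μ hg).1 ?_
  filter_upwards [h] with x hx
  exact (ENNReal.ofReal_eq_ofReal_iff (hf0 x) (hg0 x)).1 hx

theorem map_withDensity_similarity {E : Type*} [NormedAddCommGroup E] [InnerProductSpace ℝ E]
    [FiniteDimensional ℝ E] [MeasurableSpace E] [BorelSpace E] (R : E ≃ₗᵢ[ℝ] E) {c : ℝ}
    (hc : 0 < c) (x : E) {f : E → ℝ≥0∞} (hf : Measurable f) :
    (volume.withDensity f).map (fun z => x + c • R z) =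
      volume.withDensity (fun y => ENNReal.ofReal ((c ^ Module.finrank ℝ E)⁻¹) *
        f (R.symm (c⁻¹ • (y - x)))) := by
  have hT : Measurable (fun z : E => x + c • R z) := by fun_prop
  have hvol : (volume : Measure E).map (fun z => x + c • R z) =
      ENNReal.ofReal ((c ^ Module.finrank ℝ E)⁻¹) • volume := by
    have : (fun z : E => x + c • R z) = (fun z => x + z) ∘ (fun z => c • z) ∘ R := rfl
    rw [this, ← Measure.map_map (by fun_prop) (by fun_prop),
      ← Measure.map_map (by fun_prop) (by fun_prop), R.measurePreserving.map_eq,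
      Measure.map_addHaar_smul _ hc.ne', abs_of_nonneg (by positivity), Measure.map_smul,
      map_add_left_eq_self]
  have hg : Measurable (fun y : E => f (R.symm (c⁻¹ • (y - x)))) := hf.comp (by fun_prop)
  ext A hA
  rw [Measure.map_apply hT hA, withDensity_apply _ (hT hA), withDensity_apply _ hA,
    lintegral_const_mul _ hg, ← smul_eq_mul, ← lintegral_smul_measure, ← Measure.restrict_smul,
    ← hvol, setLIntegral_map hA hg hT]
  refine lintegral_congr fun z => ?_
  simp [smul_smul, hc.ne']

/-- Supplies the integrability of the Fourier transform required for inversion. Polar coordinates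
reduce it to a one-dimensional integral; the one-point space is treated apart. -/
theorem integrable_exp_neg_norm_rpow {E : Type*} [NormedAddCommGroup E] [NormedSpace ℝ E]
    [FiniteDimensional ℝ E] [MeasurableSpace E] [BorelSpace E] (μ : Measure E)
    [μ.IsAddHaarMeasure] {α c : ℝ} (hα : 0 < α) (hc : 0 < c) :
    Integrable (fun x : E => Real.exp (-(c * ‖x‖) ^ α)) μ := by
  obtain h | h := subsingleton_or_nontrivial E
  · have : IsFiniteMeasure μ := ⟨by
      have : (Set.univ : Set E) = {0} := by ext; simp [eq_iff_true_of_subsingleton]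
      rw [this]; exact isCompact_singleton.measure_lt_top⟩
    refine Integrable.mono' (integrable_const (1 : ℝ)) (by fun_prop (disch := positivity)) ?_
    refine .of_forall fun x => ?_
    simp only [Real.norm_eq_abs, Real.abs_exp, Real.exp_le_one_iff]
    have : 0 ≤ (c * ‖x‖) ^ α := by positivity
    linarith
  · refine (integrable_fun_norm_addHaar μ (f := fun r => Real.exp (-(c * r) ^ α))).2 ?_
    have h := integrableOn_rpow_mul_exp_neg_mul_rpow (s := (Module.finrank ℝ E - 1 : ℕ)) (p := α)
      (b := c ^ α) (by have : (0:ℝ) ≤ (Module.finrank ℝ E - 1 : ℕ) := by positivity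
                       linarith) hα (by positivity)
    refine h.congr_fun (fun r hr => ?_) measurableSet_Ioi
    have hr : 0 < r := hr
    simp [Real.mul_rpow hc.le hr.le]

/-! ### The stable density: scaling, symmetry, positivity at the origin, tails -/

section
variable {Ω : Type*} [MeasurableSpace Ω] {P : Measure Ω}
    {n : ℕ} {α : ℝ}
    {X : ℝ≥0 → Ω → EuclideanSpace ℝ (Fin n)}
    {p : ℝ → EuclideanSpace ℝ (Fin n) → EuclideanSpace ℝ (Fin n) → ℝ}

theorem IsSymmetricStableProcess.charFun_law (hX : IsSymmetricStableProcess α X P) (t : ℝ≥0)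
    (ξ : EuclideanSpace ℝ (Fin n)) :
    charFun (P.map (X t)) ξ = Complex.exp (-((t : ℝ) * ‖ξ‖ ^ α : ℝ)) := by
  rw [← hX.charFun_increment 0 t ξ]
  congr 1
  refine Measure.map_congr ?_
  filter_upwards [hX.start_zero] with ω hω
  simp [hω]

theorem IsTransitionDensity.law_eq (hp : IsTransitionDensity X P p) {t : ℝ≥0} (ht : 0 < t) :
    P.map (X t) = volume.withDensity (fun y => ENNReal.ofReal (p t 0 y)) := by
  rw [← hp.map_eq t ht 0]; simp

variable [IsProbabilityMeasure P]

/-- The exponent satisfies `t ‖ξ‖^α = ‖t^(1/α) R⁻¹ ξ‖^α`. Carrying the isometry `R` along gives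
self-similarity and rotation invariance at once. -/
theorem IsSymmetricStableProcess.law_scaling (hα : 0 < α) (hX : IsSymmetricStableProcess α X P)
    {t : ℝ≥0} (ht : 0 < t) (R : EuclideanSpace ℝ (Fin n) ≃ₗᵢ[ℝ] EuclideanSpace ℝ (Fin n)) :
    P.map (X t) = (P.map (X 1)).map (fun z => ((t : ℝ) ^ (1 / α)) • R z) := by
  have := Measure.isProbabilityMeasure_map (μ := P) (hX.measurable 1).aemeasurable
  have := Measure.isProbabilityMeasure_map (μ := P) (hX.measurable t).aemeasurable
  have ht' : (0 : ℝ) < t := ht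
  have := Measure.isProbabilityMeasure_map (μ := P.map (X 1))
    (f := fun z => ((t : ℝ) ^ (1 / α)) • R z) (by fun_prop)
  refine Measure.ext_of_charFun (funext fun ξ => ?_)
  have h1 : charFun ((P.map (X 1)).map (fun z => ((t : ℝ) ^ (1 / α)) • R z)) ξ =
      charFun (P.map (X 1)) (((t : ℝ) ^ (1 / α)) • R.symm ξ) := by
    rw [charFun_apply, charFun_apply, integral_map (by fun_prop) (by fun_prop)]
    congr 1 with z
    have : inner ℝ (R z) ξ = inner ℝ z (R.symm ξ) := by
      rw [← R.inner_map_map z (R.symm ξ), R.apply_symm_apply]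
    rw [real_inner_smul_left, real_inner_smul_right, this]
  rw [h1, hX.charFun_law, hX.charFun_law, norm_smul, R.symm.norm_map, Real.norm_eq_abs,
    abs_of_pos (by positivity), Real.mul_rpow (by positivity) (by positivity),
    ← Real.rpow_mul ht'.le]
  simp [hα.ne']

/-- Equality of laws identifies the densities almost everywhere; continuity in `y` upgrades this to
every point. -/
theorem IsTransitionDensity.scaling (hα : 0 < α) (hX : IsSymmetricStableProcess α X P)
    (hp : IsTransitionDensity X P p) {t : ℝ} (ht : 0 < t)
    (R : EuclideanSpace ℝ (Fin n) ≃ₗᵢ[ℝ] EuclideanSpace ℝ (Fin n))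
    (x y : EuclideanSpace ℝ (Fin n)) :
    p t x y = t ^ (-((n : ℝ) / α)) * p 1 0 (R.symm (t ^ (-(1 / α)) • (y - x))) := by
  lift t to ℝ≥0 using ht.le
  have ht0 : (0 : ℝ≥0) < t := ht
  have hc1 := hp.continuous 1 one_pos 0
  have key : p t x = fun y => (t : ℝ) ^ (-((n : ℝ) / α)) *
      p 1 0 (R.symm ((t : ℝ) ^ (-(1 / α)) • (y - x))) := by
    refine eq_of_withDensity_ofReal_eq (μ := volume) (hp.continuous t ht x)
      (continuous_const.mul (hc1.comp (by fun_prop))) (hp.nonneg t ht x)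
      (fun y => mul_nonneg (by positivity) (hp.nonneg 1 one_pos _ _)) ?_
    rw [← hp.map_eq t ht0 x]
    have : (fun ω => x + X t ω) = (fun z => x + z) ∘ X t := rfl
    rw [this, ← Measure.map_map (by fun_prop) (hX.measurable t), hX.law_scaling hα ht0 R,
      Measure.map_map (by fun_prop) (by fun_prop), hp.law_eq one_pos]
    have h2 := map_withDensity_similarity R (c := (t : ℝ) ^ (1 / α)) (by positivity) x
      (f := fun y => ENNReal.ofReal (p ((1 : ℝ≥0) : ℝ) 0 y)) (by exact hc1.measurable.ennreal_ofReal)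
    rw [Function.comp_def, h2]
    congr 1
    funext y
    rw [← ENNReal.ofReal_mul (by positivity), finrank_euclideanSpace_fin, ← Real.rpow_natCast,
      ← Real.rpow_mul ht.le, ← Real.rpow_neg ht.le, ← Real.rpow_neg ht.le]
    congr 3
    field_simp
  exact congrFun key y

/-- The reflection in the hyperplane orthogonal to `z - w` exchanges `z` and `w`. -/
theorem IsTransitionDensity.eq_of_norm_eq (hα : 0 < α) (hX : IsSymmetricStableProcess α X P)
    (hp : IsTransitionDensity X P p) {z w : EuclideanSpace ℝ (Fin n)} (h : ‖z‖ = ‖w‖) :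
    p 1 0 z = p 1 0 w := by
  have := hp.scaling hα hX one_pos (Submodule.reflection (Submodule.span ℝ {z - w})ᗮ) 0 z
  rw [this]
  simp [Submodule.reflection_sub h]

theorem IsTransitionDensity.integrable (hp : IsTransitionDensity X P p)
    (hX : IsSymmetricStableProcess α X P) : Integrable (p 1 0) := by
  have h1 := hp.law_eq (t := 1) one_pos
  have := Measure.isProbabilityMeasure_map (μ := P) (hX.measurable 1).aemeasurable
  refine ⟨(hp.continuous 1 one_pos 0).aestronglyMeasurable, ?_⟩
  rw [hasFiniteIntegral_iff_ofReal (.of_forall (hp.nonneg 1 one_pos 0))]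
  have h2 := congrArg (fun μ => μ Set.univ) h1
  simp only [measure_univ, withDensity_apply _ MeasurableSet.univ, Measure.restrict_univ,
    NNReal.coe_one] at h2
  rw [← h2]
  exact ENNReal.one_lt_top

-- Fourier inversion at `0` writes the value as the integral of a positive function.
open FourierTransform in
theorem IsTransitionDensity.pos_zero (hα : 0 < α) (hX : IsSymmetricStableProcess α X P)
    (hp : IsTransitionDensity X P p) : 0 < p 1 0 0 := by
  have h1 := hp.law_eq (t := 1) one_pos
  have hc := hp.continuous 1 one_pos 0
  have hint := integrable_exp_neg_norm_rpow (E := EuclideanSpace ℝ (Fin n)) volume hα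
    (c := 2 * Real.pi) (by positivity)
  have hF : 𝓕 (fun z => (p 1 0 z : ℂ)) =
      fun w => ((Real.exp (-(2 * Real.pi * ‖w‖) ^ α) : ℝ) : ℂ) := by
    funext w
    -- The frequency `-2πw` matches the kernel `exp(-2πi⟨z, w⟩)` of `𝓕`.
    have h2 := hX.charFun_law 1 (-(2 * Real.pi) • w)
    rw [h1, charFun_apply, integral_withDensity_eq_integral_toReal_smul
      (by exact hc.measurable.ennreal_ofReal) (by simp)] at h2
    rw [Real.fourier_eq']
    have h3 : Complex.exp (-(((1 : ℝ≥0) : ℝ) * ‖-(2 * Real.pi) • w‖ ^ α : ℝ)) =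
        ((Real.exp (-(2 * Real.pi * ‖w‖) ^ α) : ℝ) : ℂ) := by
      rw [norm_smul, Real.norm_eq_abs, abs_neg, abs_of_pos (by positivity)]
      simp
    rw [← h3, ← h2]
    congr 1 with z
    have h4 : (ENNReal.ofReal (p ((1 : ℝ≥0) : ℝ) 0 z)).toReal = p 1 0 z :=
      ENNReal.toReal_ofReal (hp.nonneg 1 one_pos 0 z)
    rw [h4, real_inner_smul_right, Complex.real_smul, smul_eq_mul, mul_comm]
    congr 2
    push_cast
    ring
  have hinv := congrFun (Continuous.fourierInv_fourier_eq (f := fun z => (p 1 0 z : ℂ))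
    (by fun_prop) (hp.integrable hX).ofReal (by rw [hF]; exact hint.ofReal)) 0
  rw [hF, Real.fourierInv_eq'] at hinv
  simp only [inner_zero_right, mul_zero, Complex.ofReal_zero, zero_mul, Complex.exp_zero,
    one_smul] at hinv
  rw [integral_complex_ofReal] at hinv
  have h5 : p 1 0 0 = ∫ w : EuclideanSpace ℝ (Fin n), Real.exp (-(2 * Real.pi * ‖w‖) ^ α) := by
    exact_mod_cast hinv.symm
  rw [h5]
  exact integral_exp_pos hint

/-- The truncation inequality bounds the tail of each coordinate by an average of `1 - φ` over `|t|
≤ 2/r`, where `1 - φ ≤ (2/r)^α`. If `‖z‖ > V`, some coordinate exceeds `r = V/n`, so a union bound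
concludes. -/
theorem IsSymmetricStableProcess.measureReal_norm_gt_le (hn : 1 ≤ n) (hα : 0 < α)
    (hX : IsSymmetricStableProcess α X P) {V : ℝ} (hV : 0 < V) :
    (P.map (X 1)).real {z | V < ‖z‖} ≤ n * (2 * (2 * n) ^ α) * V ^ (-α) := by
  have := Measure.isProbabilityMeasure_map (μ := P) (hX.measurable 1).aemeasurable
  have hn0 : (0 : ℝ) < n := by exact_mod_cast hn
  set r : ℝ := V / n with hr
  have hr0 : 0 < r := by positivity
  set e : Fin n → EuclideanSpace ℝ (Fin n) := fun i => EuclideanSpace.single i 1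
  have hsub : {z : EuclideanSpace ℝ (Fin n) | V < ‖z‖} ⊆ ⋃ i, {z | r < |inner ℝ (e i) z|} := by
    intro z hz
    by_contra hcon
    simp only [Set.mem_iUnion, Set.mem_ofPred_eq, not_exists, not_lt] at hcon
    have h1 : ‖z‖ ≤ ∑ i, ‖inner ℝ (e i) z • e i‖ := by
      have : z = ∑ i, inner ℝ (e i) z • e i := by
        ext j
        simp [e, EuclideanSpace.inner_single_left, Finset.sum_apply, Pi.single_apply]
      conv_lhs => rw [this]
      exact norm_sum_le _ _
    have h2 : ∑ i, ‖inner ℝ (e i) z • e i‖ ≤ ∑ _i : Fin n, r := by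
      refine Finset.sum_le_sum fun i _ => ?_
      simpa [norm_smul, e] using hcon i
    have h3 : ∑ _i : Fin n, r = V := by simp [hr]; field_simp
    have : V < ‖z‖ := hz
    linarith
  have hone : ∀ i, (P.map (X 1)).real {z | r < |inner ℝ (e i) z|} ≤
      2 * (2 * n) ^ α * V ^ (-α) := by
    intro i
    refine (measureReal_abs_inner_gt_le_integral_charFun hr0).trans ?_
    have hb : ‖∫ t in (-2 * r⁻¹)..(2 * r⁻¹), 1 - charFun (P.map (X 1)) (t • e i)‖ ≤
        (2 * r⁻¹) ^ α * |2 * r⁻¹ - -2 * r⁻¹| := by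
      refine intervalIntegral.norm_integral_le_of_norm_le_const fun t ht => ?_
      rw [Set.uIoc_of_le (by have : 0 < r⁻¹ := by positivity
                             linarith)] at ht
      rw [hX.charFun_law]
      have ht2 : |t| ≤ 2 * r⁻¹ := abs_le.2 ⟨by linarith [ht.1], ht.2⟩
      have he : ‖t • e i‖ = |t| := by simp [norm_smul, e]
      rw [he]
      simp only [NNReal.coe_one, one_mul]
      rw [← Complex.ofReal_neg, ← Complex.ofReal_exp, ← Complex.ofReal_one, ← Complex.ofReal_sub,
        Complex.norm_real, Real.norm_eq_abs, abs_of_nonneg]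
      · have := Real.one_sub_le_exp_neg (|t| ^ α)
        have h4 : |t| ^ α ≤ (2 * r⁻¹) ^ α := by gcongr
        linarith
      · have : 0 ≤ |t| ^ α := by positivity
        have := Real.exp_le_one_iff.2 (neg_nonpos.2 this)
        linarith
    have h5 : |2 * r⁻¹ - -2 * r⁻¹| = 4 * r⁻¹ := by
      rw [abs_of_nonneg (by have : 0 < r⁻¹ := by positivity
                            linarith)]; ring
    rw [h5] at hb
    have h6 : (2 * r⁻¹) ^ α = (2 * n) ^ α * V ^ (-α) := by
      rw [Real.rpow_neg hV.le, ← Real.inv_rpow hV.le, ← Real.mul_rpow (by positivity) (by positivity)]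
      congr 1; rw [hr]; field_simp
    calc _ ≤ 2⁻¹ * r * ((2 * r⁻¹) ^ α * (4 * r⁻¹)) := by gcongr
      _ = _ := by rw [h6]; field_simp; ring
  calc _ ≤ (P.map (X 1)).real (⋃ i, {z | r < |inner ℝ (e i) z|}) := measureReal_mono hsub
    _ ≤ ∑ i, (P.map (X 1)).real {z | r < |inner ℝ (e i) z|} := measureReal_iUnion_fintype_le _
    _ ≤ ∑ _i : Fin n, 2 * (2 * n) ^ α * V ^ (-α) := Finset.sum_le_sum fun i _ => hone i
    _ = _ := by simp; ring

theorem IsTransitionDensity.exists_radial_profile (hn : 1 ≤ n) (hα : 0 < α)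
    (hX : IsSymmetricStableProcess α X P) (hp : IsTransitionDensity X P p) :
    ∃ g : ℝ → ℝ, Continuous g ∧ (∀ r, 0 ≤ g r) ∧ 0 < g 0 ∧
      (∃ C : ℝ≥0, ∀ V : ℝ, 0 < V → ∫⁻ v in Set.Ioi V, ENNReal.ofReal (v ^ ((n : ℝ) - 1) * g v) ≤
        C * ENNReal.ofReal (V ^ (-α))) ∧
      ∀ t : ℝ, 0 < t → ∀ x y, p t x y =
        t ^ (-((n : ℝ) / α)) * g (t ^ (-(1 / α)) * ‖y - x‖) := by
  have : Nonempty (Fin n) := ⟨⟨0, hn⟩⟩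
  set e : EuclideanSpace ℝ (Fin n) := EuclideanSpace.single ⟨0, hn⟩ 1
  have he : ‖e‖ = 1 := by simp [e]
  set g : ℝ → ℝ := fun r => p 1 0 (r • e) with hg
  have hc := hp.continuous 1 one_pos 0
  have hgc : Continuous g := hc.comp (by fun_prop)
  have hg0 : ∀ r, 0 ≤ g r := fun r => hp.nonneg 1 one_pos 0 _
  have hgn : ∀ z, p 1 0 z = g ‖z‖ := fun z =>
    hp.eq_of_norm_eq hα hX (by simp [norm_smul, he])
  refine ⟨g, hgc, hg0, ?_, ?_, ?_⟩
  · simpa [hg] using hp.pos_zero hα hX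
  · set b : ℝ := (volume : Measure (EuclideanSpace ℝ (Fin n))).real (Metric.ball 0 1)
    have hb : 0 < b := ENNReal.toReal_pos (Metric.measure_ball_pos _ _ one_pos).ne'
      measure_ball_lt_top.ne
    have hn0 : (0 : ℝ) < n := by exact_mod_cast hn
    -- `n * b` is the area of the unit sphere, the factor coming from polar coordinates; the rest is
    -- the tail constant.
    refine ⟨((n * b)⁻¹ * (n * (2 * (2 * n) ^ α))).toNNReal, fun V hV => ?_⟩
    have hnt : Nontrivial (EuclideanSpace ℝ (Fin n)) := ⟨e, 0, by
      intro h; rw [h] at he; simp at he⟩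
    set f : ℝ → ℝ := (Set.Ioi V).indicator g
    have hfn : (fun z : EuclideanSpace ℝ (Fin n) => f ‖z‖) = {z | V < ‖z‖}.indicator (p 1 0) := by
      funext z
      by_cases hz : V < ‖z‖ <;> simp [f, Set.indicator, hz, hgn]
    have hmeas : MeasurableSet {z : EuclideanSpace ℝ (Fin n) | V < ‖z‖} :=
      measurableSet_lt measurable_const measurable_norm
    have hfi : Integrable (fun z : EuclideanSpace ℝ (Fin n) => f ‖z‖) := by
      rw [hfn]; exact (hp.integrable hX).indicator hmeas
    have hfi2 := (integrable_fun_norm_addHaar volume).1 hfi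
    have heq := integral_fun_norm_addHaar (volume : Measure (EuclideanSpace ℝ (Fin n))) f
    have hpow : ∀ v : ℝ, 0 < v → v ^ (n - 1) = v ^ ((n : ℝ) - 1) := fun v hv => by
      rw [← Real.rpow_natCast, Nat.cast_sub hn, Nat.cast_one]
    have htail : ∫ z : EuclideanSpace ℝ (Fin n), f ‖z‖ = (P.map (X 1)).real {z | V < ‖z‖} := by
      rw [hfn, integral_indicator hmeas, hp.law_eq one_pos, measureReal_def,
        withDensity_apply _ hmeas, integral_eq_lintegral_of_nonneg_ae
          (.of_forall (hp.nonneg 1 one_pos 0)) hc.aestronglyMeasurable.restrict]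
      rfl
    have hle := hX.measureReal_norm_gt_le hn hα hV
    rw [← htail, heq, finrank_euclideanSpace_fin, nsmul_eq_mul, smul_eq_mul] at hle
    have hlin : ∫⁻ v in Set.Ioi V, ENNReal.ofReal (v ^ ((n : ℝ) - 1) * g v) =
        ENNReal.ofReal (∫ y in Set.Ioi (0 : ℝ), y ^ (n - 1) • f y) := by
      rw [finrank_euclideanSpace_fin] at hfi2
      rw [ofReal_integral_eq_lintegral_ofReal hfi2]
      · rw [← lintegral_indicator measurableSet_Ioi, ← lintegral_indicator measurableSet_Ioi]
        refine lintegral_congr fun v => ?_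
        by_cases hv : V < v
        · simp [f, Set.indicator, hv, hV.trans hv, hpow v (hV.trans hv)]
        · simp [f, Set.indicator, hv]
      · refine (ae_restrict_iff' measurableSet_Ioi).2 (.of_forall fun v hv => ?_)
        have hv : 0 < v := hv
        exact smul_nonneg (by positivity) (Set.indicator_nonneg (fun _ _ => hg0 _) _)
    rw [hlin, ← ENNReal.ofReal, ← ENNReal.ofReal_mul (by positivity)]
    refine ENNReal.ofReal_le_ofReal ?_
    rw [mul_assoc, inv_mul_eq_div, le_div_iff₀ (by positivity)]
    calc _ = n * (b * ∫ y in Set.Ioi (0 : ℝ), y ^ (n - 1) • f y) := by ring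
      _ ≤ _ := hle
  · intro t ht x y
    rw [hp.scaling hα hX ht (LinearIsometryEquiv.refl ℝ _) x y, hgn]
    simp only [LinearIsometryEquiv.norm_map, norm_smul, Real.norm_eq_abs]
    rw [abs_of_pos (by positivity)]

end

/-! ### Power substitutions on the half-line -/

theorem setLIntegral_image_const_mul_rpow {β c : ℝ} (hβ : β ≠ 0) (hc : 0 < c) {S : Set ℝ}
    (hS : MeasurableSet S) (hS0 : S ⊆ Set.Ioi 0) (F : ℝ → ℝ≥0∞) :
    ∫⁻ s in (fun r => c * r ^ β) '' S, F s =
      ∫⁻ r in S, ENNReal.ofReal (c * |β| * r ^ (β - 1)) * F (c * r ^ β) := by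
  rw [lintegral_image_eq_lintegral_abs_deriv_mul hS
    (f' := fun r => c * (β * r ^ (β - 1)))
    (fun r hr => ((Real.hasDerivAt_rpow_const (Or.inl (hS0 hr).ne')).const_mul c).hasDerivWithinAt)
    (fun r hr s hs h => (Real.rpow_left_inj (hS0 hr).le (hS0 hs).le hβ).1
      (mul_left_cancel₀ hc.ne' h))]
  refine setLIntegral_congr_fun hS fun r hr => ?_
  have hr0 : 0 < r := hS0 hr
  rw [abs_mul, abs_mul, abs_of_pos hc, abs_of_pos (Real.rpow_pos_of_pos hr0 _), mul_assoc]

theorem setLIntegral_Ioc_rpow {α T : ℝ} (hα : 0 < α) (hT : 0 < T) (F : ℝ → ℝ≥0∞) :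
    ∫⁻ s in Set.Ioc 0 (T ^ α), F s =
      ∫⁻ r in Set.Ioc 0 T, ENNReal.ofReal (α * r ^ (α - 1)) * F (r ^ α) := by
  have himg : (fun r : ℝ => 1 * r ^ α) '' Set.Ioc 0 T = Set.Ioc 0 (T ^ α) := by
    ext s
    simp only [one_mul, Set.mem_image, Set.mem_Ioc]
    constructor
    · rintro ⟨r, ⟨h0, h1⟩, rfl⟩
      exact ⟨by positivity, by gcongr⟩
    · rintro ⟨h0, h1⟩
      refine ⟨s ^ α⁻¹, ⟨by positivity, ?_⟩, Real.rpow_inv_rpow h0.le hα.ne'⟩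
      rw [← Real.rpow_rpow_inv hT.le hα.ne']
      gcongr
  rw [← himg, setLIntegral_image_const_mul_rpow hα.ne' one_pos measurableSet_Ioc
    (fun r hr => hr.1)]
  simp [abs_of_pos hα]

theorem setLIntegral_Ioc_const_mul {c T : ℝ} (hc : 0 < c) (F : ℝ → ℝ≥0∞) :
    ∫⁻ s in Set.Ioc 0 (c * T), F s =
      ENNReal.ofReal c * ∫⁻ r in Set.Ioc 0 T, F (c * r) := by
  have himg : (fun r : ℝ => c * r ^ (1 : ℝ)) '' Set.Ioc 0 T = Set.Ioc 0 (c * T) := by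
    simp only [Real.rpow_one]
    rw [Set.image_mul_left_Ioc hc, mul_zero]
  rw [← himg, setLIntegral_image_const_mul_rpow one_ne_zero hc measurableSet_Ioc
    (fun r hr => hr.1), ← lintegral_const_mul' _ _ ENNReal.ofReal_ne_top]
  simp

theorem setLIntegral_Ioi_div {ρ m : ℝ} (hρ : 0 < ρ) (hm : 0 < m) (F : ℝ → ℝ≥0∞) :
    ∫⁻ v in Set.Ioi (ρ / m), F v =
      ∫⁻ r in Set.Ioo 0 m, ENNReal.ofReal (ρ * r ^ (-2 : ℝ)) * F (ρ / r) := by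
  have himg : (fun r : ℝ => ρ * r ^ (-1 : ℝ)) '' Set.Ioo 0 m = Set.Ioi (ρ / m) := by
    ext v
    simp only [Set.mem_image, Set.mem_Ioo, Set.mem_Ioi, Real.rpow_neg_one]
    constructor
    · rintro ⟨r, ⟨h0, h1⟩, rfl⟩
      rw [← div_eq_mul_inv]
      gcongr
    · intro h
      have hv : 0 < v := lt_trans (by positivity) h
      refine ⟨ρ / v, ⟨by positivity, ?_⟩, by field_simp⟩
      rw [div_lt_iff₀ hm] at h
      rw [div_lt_iff₀ hv]; linarith
  rw [← himg, setLIntegral_image_const_mul_rpow (by norm_num) hρ measurableSet_Ioo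
    (fun r hr => hr.1)]
  refine setLIntegral_congr_fun measurableSet_Ioo fun r hr => ?_
  rw [Real.rpow_neg_one, ← div_eq_mul_inv]
  norm_num

/-- As `κ ≤ 1`, the integrand is at least `(2ρ)^(κ-1)` on an interval of length `ρ`. This trades a
power at one radius for an integral over radii. -/
theorem ofReal_rpow_le_mul_setLIntegral {κ ρ : ℝ} (hκ : κ ≤ 1) (hρ : 0 < ρ) :
    ENNReal.ofReal (ρ ^ κ) ≤ ENNReal.ofReal (2 ^ (1 - κ)) *
      ∫⁻ r in Set.Ioc ρ (2 * ρ), ENNReal.ofReal (r ^ (κ - 1)) := by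
  have h1 : ENNReal.ofReal ((2 * ρ) ^ (κ - 1)) * ENNReal.ofReal ρ ≤
      ∫⁻ r in Set.Ioc ρ (2 * ρ), ENNReal.ofReal (r ^ (κ - 1)) := by
    have hv : volume (Set.Ioc ρ (2 * ρ)) = ENNReal.ofReal ρ := by
      rw [Real.volume_Ioc]; congr 1; ring
    rw [← hv, ← setLIntegral_const]
    refine setLIntegral_mono' measurableSet_Ioc fun r hr => ENNReal.ofReal_le_ofReal ?_
    exact Real.rpow_le_rpow_of_nonpos (hρ.trans hr.1) hr.2 (by linarith)
  refine le_trans (le_of_eq ?_) (mul_le_mul_right h1 _)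
  rw [← ENNReal.ofReal_mul (by positivity), ← ENNReal.ofReal_mul (by positivity)]
  congr 1
  rw [Real.mul_rpow (by norm_num) hρ.le]
  have h2 : (2 : ℝ) ^ (κ - 1) * 2 ^ (1 - κ) = 1 := by
    rw [← Real.rpow_add (by norm_num)]; simp
  have h3 : ρ ^ (κ - 1) * ρ = ρ ^ κ := by
    rw [Real.rpow_sub_one hρ.ne']; field_simp
  linear_combination (-(ρ ^ κ)) * h2 - (2 : ℝ) ^ (κ - 1) * 2 ^ (1 - κ) * h3

/-! ### Ball masses controlled by the ball modulus -/

section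
variable {n : ℕ} {α : ℝ} {g : ℝ → ℝ}

/-- The quantity `sup_x ∫₀ᵀ μ{y : ‖x - y‖ ≤ r} / r ^ (n + 1 - α) dr`. -/
noncomputable def stableKatoModulus (α : ℝ) (μ : Measure (EuclideanSpace ℝ (Fin n))) (T : ℝ) :
    ℝ≥0∞ :=
  ⨆ x : EuclideanSpace ℝ (Fin n), ∫⁻ s in Set.Ioc 0 T,
    μ {y | ‖x - y‖ ≤ s} / ENNReal.ofReal (s ^ ((n : ℝ) + 1 - α))

theorem div_ofReal_rpow_eq {κ r : ℝ} (hr : 0 < r) (a : ℝ≥0∞) :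
    a / ENNReal.ofReal (r ^ (1 - κ)) = ENNReal.ofReal (r ^ (κ - 1)) * a := by
  rw [div_eq_mul_inv, ← ENNReal.ofReal_inv_of_pos (by positivity), ← Real.rpow_neg hr.le, mul_comm,
    neg_sub]

theorem setLIntegral_le_stableKatoModulus (μ : Measure (EuclideanSpace ℝ (Fin n))) (T : ℝ)
    (x : EuclideanSpace ℝ (Fin n)) :
    ∫⁻ r in Set.Ioc 0 T, ENNReal.ofReal (r ^ (α - n - 1)) * μ {y | ‖x - y‖ ≤ r} ≤
      stableKatoModulus α μ T := by
  refine le_trans (le_of_eq ?_) (le_iSup _ x)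
  refine setLIntegral_congr_fun measurableSet_Ioc fun r hr => ?_
  rw [← div_ofReal_rpow_eq hr.1]
  congr 3; ring

theorem stableKatoModulus_le {μ : Measure (EuclideanSpace ℝ (Fin n))} {T : ℝ} {C : ℝ≥0∞}
    (h : ∀ x, ∫⁻ r in Set.Ioc 0 T, ENNReal.ofReal (r ^ (α - n - 1)) * μ {y | ‖x - y‖ ≤ r} ≤ C) :
    stableKatoModulus α μ T ≤ C := by
  refine iSup_le fun x => le_trans (le_of_eq ?_) (h x)
  refine setLIntegral_congr_fun measurableSet_Ioc fun r hr => ?_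
  rw [← div_ofReal_rpow_eq hr.1]
  congr 3; ring

/-- Every ball of radius `r ∈ (T, 2T]` contains the concentric ball of radius `T`. -/
theorem ofReal_mul_measure_le_stableKatoModulus (hα : α ≤ n + 1)
    (μ : Measure (EuclideanSpace ℝ (Fin n))) {T : ℝ} (hT : 0 < T)
    (x : EuclideanSpace ℝ (Fin n)) :
    ENNReal.ofReal (T ^ (α - n)) * μ {y | ‖x - y‖ ≤ T} ≤
      ENNReal.ofReal (2 ^ (1 - (α - n))) * stableKatoModulus α μ (2 * T) := by
  calc _ ≤ (ENNReal.ofReal (2 ^ (1 - (α - n))) *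
        ∫⁻ r in Set.Ioc T (2 * T), ENNReal.ofReal (r ^ (α - n - 1))) * μ {y | ‖x - y‖ ≤ T} := by
        gcongr; exact ofReal_rpow_le_mul_setLIntegral (by linarith) hT
    _ = ENNReal.ofReal (2 ^ (1 - (α - n))) *
        ∫⁻ r in Set.Ioc T (2 * T), ENNReal.ofReal (r ^ (α - n - 1)) * μ {y | ‖x - y‖ ≤ T} := by
        rw [mul_assoc, lintegral_mul_const _ (by fun_prop)]
    _ ≤ ENNReal.ofReal (2 ^ (1 - (α - n))) *
        ∫⁻ r in Set.Ioc T (2 * T), ENNReal.ofReal (r ^ (α - n - 1)) * μ {y | ‖x - y‖ ≤ r} := by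
        gcongr ENNReal.ofReal (2 ^ (1 - (α - n))) * ?_
        refine setLIntegral_mono' measurableSet_Ioc fun r hr => ?_
        gcongr
        exact hr.1.le
    _ ≤ _ := by
        gcongr
        refine le_trans (lintegral_mono_set ?_) (setLIntegral_le_stableKatoModulus μ (2 * T) x)
        exact Set.Ioc_subset_Ioc_left hT.le

/-- The measure is arbitrary at the outset; local finiteness makes it s-finite, which Tonelli's
theorem requires. -/
theorem isLocallyFiniteMeasure_of_stableKatoModulus_ne_top (hα : α ≤ n + 1)
    {μ : Measure (EuclideanSpace ℝ (Fin n))} {T : ℝ} (hT : 0 < T)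
    (h : stableKatoModulus α μ T ≠ ⊤) : IsLocallyFiniteMeasure μ := by
  refine ⟨fun x => ⟨{y | ‖x - y‖ ≤ T / 2}, ?_, ?_⟩⟩
  · filter_upwards [Metric.closedBall_mem_nhds x (half_pos hT)] with y hy
    rw [Metric.mem_closedBall, dist_comm, dist_eq_norm] at hy
    exact hy
  · have h1 := ofReal_mul_measure_le_stableKatoModulus hα μ (half_pos hT) x
    rw [mul_div_cancel₀ T two_ne_zero] at h1
    have h2 := h1.trans_lt (ENNReal.mul_lt_top ENNReal.ofReal_lt_top h.lt_top)
    have h3 : 0 < ENNReal.ofReal ((T / 2) ^ (α - n)) := ENNReal.ofReal_pos.2 (by positivity)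
    by_contra hcon
    rw [not_lt_top_iff.1 hcon, ENNReal.mul_top h3.ne'] at h2
    exact lt_irrefl _ h2

/-- Within distance `T` the weight drops by a factor of at most `2^(n+α)`, so its value at `y` is
bounded by its Lebesgue average over the ball of radius `T` at `y`. After exchanging the integrals
each `w` sees mass at most `S`, and the weight is Lebesgue integrable because `n + α > n`. -/
theorem exists_lintegral_one_add_norm_div_le (hα : 0 < α) :
    ∃ C : ℝ≥0, ∀ (μ : Measure (EuclideanSpace ℝ (Fin n))) [SFinite μ] (T : ℝ), 0 < T →
      ∀ x S, (∀ w, μ {y | ‖w - y‖ ≤ T} ≤ S) →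
      ∫⁻ y, ENNReal.ofReal ((1 + ‖y - x‖ / T) ^ (-(n + α))) ∂μ ≤ C * S := by
  set E := EuclideanSpace ℝ (Fin n)
  set I : ℝ≥0∞ := ∫⁻ z : E, ENNReal.ofReal ((1 + ‖z‖) ^ (-(n + α))) with hI
  have hIfin : I < ⊤ := by
    refine finite_integral_one_add_norm ?_
    rw [finrank_euclideanSpace_fin]; linarith
  set b : ℝ≥0∞ := volume (Metric.closedBall (0 : E) 1) with hb
  have hb0 : b ≠ 0 := (Metric.measure_closedBall_pos _ _ one_pos).ne'
  have hbt : b ≠ ⊤ := measure_closedBall_lt_top.ne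
  have hK : ENNReal.ofReal (2 ^ ((n : ℝ) + α)) * I / b ≠ ⊤ :=
    ENNReal.div_ne_top (ENNReal.mul_ne_top ENNReal.ofReal_ne_top hIfin.ne) hb0
  refine ⟨(ENNReal.ofReal (2 ^ ((n : ℝ) + α)) * I / b).toNNReal, fun μ _ T hT x S hS => ?_⟩
  rw [ENNReal.coe_toNNReal hK]
  set h : E → ℝ≥0∞ := fun w => ENNReal.ofReal ((1 + ‖w - x‖ / T) ^ (-(n + α))) with hh
  have hhm : Measurable h := by fun_prop
  have hTn : ENNReal.ofReal (T ^ n) ≠ 0 := (ENNReal.ofReal_pos.2 (by positivity)).ne'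
  have hvol : ∫⁻ w, h w = ENNReal.ofReal (T ^ n) * I := by
    have h1 : ∫⁻ w, h w = ∫⁻ w : E, ENNReal.ofReal ((1 + ‖T⁻¹ • w‖) ^ (-(n + α))) := by
      refine Eq.trans ?_ (lintegral_sub_right_eq_self
        (fun w : E => ENNReal.ofReal ((1 + ‖T⁻¹ • w‖) ^ (-(n + α)))) x)
      refine lintegral_congr fun w => ?_
      simp [hh, norm_smul, abs_of_pos hT, div_eq_inv_mul]
    rw [h1, ← lintegral_map (f := fun z : E => ENNReal.ofReal ((1 + ‖z‖) ^ (-(n + α))))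
      (by fun_prop) (by fun_prop : Measurable fun w : E => T⁻¹ • w),
      Measure.map_addHaar_smul _ (inv_ne_zero hT.ne'), lintegral_smul_measure, smul_eq_mul,
      finrank_euclideanSpace_fin, inv_pow, inv_inv, abs_of_nonneg (by positivity)]
  set D : Set (E × E) := {q | ‖q.2 - q.1‖ ≤ T} with hD
  have hDm : MeasurableSet D := measurableSet_le (by fun_prop) measurable_const
  have hpt : ∀ y, ENNReal.ofReal (T ^ n) * b * h y ≤
      ENNReal.ofReal (2 ^ ((n : ℝ) + α)) * ∫⁻ w, D.indicator (fun q => h q.2) (y, w) := by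
    intro y
    have hball : ENNReal.ofReal (T ^ n) * b = volume (Metric.closedBall y T) := by
      rw [Measure.addHaar_closedBall' _ _ hT.le, finrank_euclideanSpace_fin]
    rw [hball, mul_comm, ← setLIntegral_const, ← lintegral_const_mul' _ _ ENNReal.ofReal_ne_top,
      ← lintegral_indicator measurableSet_closedBall]
    refine lintegral_mono fun w => ?_
    by_cases hw : w ∈ Metric.closedBall y T
    · have hw' : ‖w - y‖ ≤ T := by rwa [← dist_eq_norm]
      have hwD : (y, w) ∈ D := hw'
      simp only [Set.indicator_of_mem hw, Set.indicator_of_mem hwD, hh]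
      rw [← ENNReal.ofReal_mul (by positivity)]
      refine ENNReal.ofReal_le_ofReal ?_
      have h2 : (1 + ‖w - x‖ / T) ≤ 2 * (1 + ‖y - x‖ / T) := by
        have : ‖w - x‖ ≤ T + ‖y - x‖ := by
          calc ‖w - x‖ = ‖(w - y) + (y - x)‖ := by simp
            _ ≤ _ := (norm_add_le _ _).trans (by gcongr)
        have h3 : ‖w - x‖ / T ≤ 1 + ‖y - x‖ / T := by
          rw [div_le_iff₀ hT, add_mul, div_mul_cancel₀ _ hT.ne', one_mul]; exact this
        have : 0 ≤ ‖y - x‖ / T := by positivity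
        linarith
      have h4 : (2 * (1 + ‖y - x‖ / T)) ^ (-(n + α)) ≤ (1 + ‖w - x‖ / T) ^ (-(n + α)) :=
        Real.rpow_le_rpow_of_nonpos (by positivity) h2 (by
          have : (0 : ℝ) ≤ n := by positivity
          linarith)
      rw [Real.mul_rpow (by norm_num) (by positivity)] at h4
      calc (1 + ‖y - x‖ / T) ^ (-(n + α)) = 2 ^ ((n : ℝ) + α) *
            (2 ^ (-((n : ℝ) + α)) * (1 + ‖y - x‖ / T) ^ (-(n + α))) := by
            rw [← mul_assoc, ← Real.rpow_add (by norm_num)]; simp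
        _ ≤ _ := by gcongr
    · rw [Set.indicator_of_notMem hw]; exact zero_le
  have hDh : Measurable (D.indicator (fun q : E × E => h q.2)) :=
    (hhm.comp measurable_snd).indicator hDm
  have hmain : ENNReal.ofReal (T ^ n) * b * ∫⁻ y, h y ∂μ ≤
      ENNReal.ofReal (2 ^ ((n : ℝ) + α)) * (S * (ENNReal.ofReal (T ^ n) * I)) := by
    calc _ = ∫⁻ y, ENNReal.ofReal (T ^ n) * b * h y ∂μ := (lintegral_const_mul _ hhm).symm
      _ ≤ ∫⁻ y, ENNReal.ofReal (2 ^ ((n : ℝ) + α)) *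
          (∫⁻ w, D.indicator (fun q => h q.2) (y, w)) ∂μ := lintegral_mono hpt
      _ = ENNReal.ofReal (2 ^ ((n : ℝ) + α)) *
          ∫⁻ y, (∫⁻ w, D.indicator (fun q => h q.2) (y, w)) ∂μ :=
        lintegral_const_mul' _ _ ENNReal.ofReal_ne_top
      _ = ENNReal.ofReal (2 ^ ((n : ℝ) + α)) *
          ∫⁻ w, ∫⁻ y, D.indicator (fun q => h q.2) (y, w) ∂μ := by
        rw [lintegral_lintegral_swap (f := fun y w => D.indicator (fun q => h q.2) (y, w))
          hDh.aemeasurable]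
      _ ≤ ENNReal.ofReal (2 ^ ((n : ℝ) + α)) * ∫⁻ w, S * h w := by
        gcongr with w
        have : ∀ y, D.indicator (fun q : E × E => h q.2) (y, w) =
            {y | ‖w - y‖ ≤ T}.indicator (fun _ => h w) y := fun y => by
          simp [Set.indicator, hD]
        simp_rw [this]
        rw [lintegral_indicator (measurableSet_le (by fun_prop) measurable_const),
          setLIntegral_const, mul_comm]
        gcongr
        exact hS w
      _ = _ := by rw [lintegral_const_mul _ hhm, hvol]
  -- Cancel the volume `T^n b` of a ball of radius `T`.
  rw [← ENNReal.mul_le_mul_iff_right (a := ENNReal.ofReal (T ^ n) * b) (mul_ne_zero hTn hb0)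
    (ENNReal.mul_ne_top ENNReal.ofReal_ne_top hbt)]
  refine hmain.trans (le_of_eq ?_)
  rw [div_eq_mul_inv]
  calc _ = ENNReal.ofReal (T ^ n) * (b * b⁻¹) * (ENNReal.ofReal (2 ^ ((n : ℝ) + α)) * I) * S := by
        rw [ENNReal.mul_inv_cancel hb0 hbt]; ring
    _ = _ := by ring
end

/-! ### Two-sided comparison of the heat and ball moduli -/

section
variable {n : ℕ} {α : ℝ} {g : ℝ → ℝ}
    {p : ℝ → EuclideanSpace ℝ (Fin n) → EuclideanSpace ℝ (Fin n) → ℝ}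

/-- The quantity `sup_x ∫₀ᵗ ∫ p_s(x,y) μ(dy) ds`. -/
noncomputable def heatKatoModulus
    (p : ℝ → EuclideanSpace ℝ (Fin n) → EuclideanSpace ℝ (Fin n) → ℝ)
    (μ : Measure (EuclideanSpace ℝ (Fin n))) (t : ℝ) : ℝ≥0∞ :=
  ⨆ x : EuclideanSpace ℝ (Fin n), ∫⁻ s in Set.Ioc 0 t, ∫⁻ y, ENNReal.ofReal (p s x y) ∂μ

theorem setLIntegral_lintegral_density_eq (hα : 0 < α)
    (hpg : ∀ t : ℝ, 0 < t → ∀ x y, p t x y =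
        t ^ (-((n : ℝ) / α)) * g (t ^ (-(1 / α)) * ‖y - x‖))
    (μ : Measure (EuclideanSpace ℝ (Fin n))) {T : ℝ} (hT : 0 < T)
    (x : EuclideanSpace ℝ (Fin n)) :
    ∫⁻ s in Set.Ioc 0 (T ^ α), ∫⁻ y, ENNReal.ofReal (p s x y) ∂μ =
      ENNReal.ofReal α * ∫⁻ r in Set.Ioc 0 T, ENNReal.ofReal (r ^ (α - n - 1)) *
        ∫⁻ y, ENNReal.ofReal (g (‖y - x‖ / r)) ∂μ := by
  rw [setLIntegral_Ioc_rpow hα hT, ← lintegral_const_mul' _ _ ENNReal.ofReal_ne_top]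
  refine setLIntegral_congr_fun measurableSet_Ioc fun r hr => ?_
  have hr0 : 0 < r := hr.1
  have h1 : ∀ y, ENNReal.ofReal (p (r ^ α) x y) =
      ENNReal.ofReal (r ^ (-(n : ℝ))) * ENNReal.ofReal (g (‖y - x‖ / r)) := by
    intro y
    rw [hpg _ (by positivity), ← Real.rpow_mul hr0.le, ← Real.rpow_mul hr0.le,
      ← ENNReal.ofReal_mul (by positivity)]
    have e1 : α * -((n : ℝ) / α) = -n := by field_simp
    have e2 : α * -(1 / α) = -1 := by field_simp
    rw [e1, e2, Real.rpow_neg_one, div_eq_inv_mul]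
  simp only [h1]
  rw [lintegral_const_mul' _ _ ENNReal.ofReal_ne_top, ← mul_assoc, ← mul_assoc,
    ← ENNReal.ofReal_mul (by positivity), ← ENNReal.ofReal_mul (by positivity), mul_assoc,
    ← Real.rpow_add hr0]
  congr 4
  ring

/-- By continuity `g ≥ g(0)/2` on `[0, ε]`, so `∫ g(‖y - x‖/r) μ(dy)` dominates the mass of the ball
of radius `εr`; rescaling `r` by `ε` gives the constant. -/
theorem exists_stableKatoModulus_le (hα : 0 < α) (hgc : Continuous g) (hg0 : 0 < g 0)
    (hpg : ∀ t : ℝ, 0 < t → ∀ x y, p t x y =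
        t ^ (-((n : ℝ) / α)) * g (t ^ (-(1 / α)) * ‖y - x‖)) :
    ∃ ε : ℝ, 0 < ε ∧ ∃ C : ℝ≥0, ∀ (μ : Measure (EuclideanSpace ℝ (Fin n))) (T : ℝ), 0 < T →
      stableKatoModulus α μ (ε * T) ≤ C * heatKatoModulus p μ (T ^ α) := by
  obtain ⟨ε, hε, hge⟩ : ∃ ε > 0, ∀ v, |v| ≤ ε → g 0 / 2 ≤ g v := by
    have : ∀ᶠ v in 𝓝 (0 : ℝ), g 0 / 2 < g v :=
      hgc.continuousAt.eventually (lt_mem_nhds (half_lt_self hg0))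
    obtain ⟨ε, hε, h⟩ := Metric.eventually_nhds_iff.1 this
    refine ⟨ε / 2, half_pos hε, fun v hv => (h ?_).le⟩
    rw [Real.dist_eq, sub_zero]; linarith
  refine ⟨ε, hε, (ε * ε ^ (α - n - 1) * (g 0 / 2)⁻¹ * α⁻¹).toNNReal, fun μ T hT => ?_⟩
  refine stableKatoModulus_le fun x => ?_
  refine le_trans ?_ (mul_le_mul_right (le_iSup (fun x => ∫⁻ s in Set.Ioc 0 (T ^ α),
    ∫⁻ y, ENNReal.ofReal (p s x y) ∂μ) x) _)
  rw [setLIntegral_lintegral_density_eq hα hpg μ hT x, setLIntegral_Ioc_const_mul hε,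
    ← ENNReal.ofReal, ← mul_assoc, ← ENNReal.ofReal_mul (by positivity),
    inv_mul_cancel_right₀ hα.ne', mul_assoc ε, ENNReal.ofReal_mul hε.le, mul_assoc]
  gcongr ENNReal.ofReal ε * ?_
  rw [← lintegral_const_mul' _ _ ENNReal.ofReal_ne_top]
  refine setLIntegral_mono' measurableSet_Ioc fun r hr => ?_
  have hr0 : 0 < r := hr.1
  have h1 : ENNReal.ofReal (g 0 / 2) * μ {y | ‖x - y‖ ≤ ε * r} ≤
      ∫⁻ y, ENNReal.ofReal (g (‖y - x‖ / r)) ∂μ := by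
    rw [← setLIntegral_const]
    refine le_trans (setLIntegral_mono' (measurableSet_le (by fun_prop) measurable_const)
      fun y hy => ENNReal.ofReal_le_ofReal (hge _ ?_)) (setLIntegral_le_lintegral _ _)
    have hy : ‖x - y‖ ≤ ε * r := hy
    rw [abs_of_nonneg (by positivity), div_le_iff₀ hr0, norm_sub_rev]
    exact hy
  calc ENNReal.ofReal ((ε * r) ^ (α - n - 1)) * μ {y | ‖x - y‖ ≤ ε * r}
      = ENNReal.ofReal (ε ^ (α - n - 1) * (g 0 / 2)⁻¹) * (ENNReal.ofReal (r ^ (α - n - 1)) *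
        (ENNReal.ofReal (g 0 / 2) * μ {y | ‖x - y‖ ≤ ε * r})) := by
        rw [← mul_assoc, ← mul_assoc, ← ENNReal.ofReal_mul (by positivity),
          ← ENNReal.ofReal_mul (by positivity), Real.mul_rpow hε.le hr0.le]
        congr 2
        field_simp
    _ ≤ _ := by gcongr

/-- With `v = ρ/r`, the measure `r^(-n-1) dr` becomes `ρ^(-n) v^(n-1) dv`. The remaining `r^α` is at
most `m^α`, and the tail beyond `ρ/m` supplies `(ρ/m)^(-α)`. -/
theorem setLIntegral_Ioo_profile_le {C : ℝ≥0} (hα : 0 < α)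
    (htail : ∀ V : ℝ, 0 < V → ∫⁻ v in Set.Ioi V, ENNReal.ofReal (v ^ ((n : ℝ) - 1) * g v) ≤
      C * ENNReal.ofReal (V ^ (-α))) {ρ m : ℝ} (hρ : 0 < ρ) (hm : 0 < m) :
    ∫⁻ r in Set.Ioo 0 m, ENNReal.ofReal (r ^ (α - n - 1)) * ENNReal.ofReal (g (ρ / r)) ≤
      C * ENNReal.ofReal (m ^ (2 * α) * ρ ^ (-(n : ℝ) - α)) := by
  have h1 := htail (ρ / m) (by positivity)
  rw [setLIntegral_Ioi_div hρ hm] at h1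
  calc _ ≤ ∫⁻ r in Set.Ioo 0 m, ENNReal.ofReal (m ^ α * ρ ^ (-(n : ℝ))) *
        (ENNReal.ofReal (ρ * r ^ (-2 : ℝ)) *
          ENNReal.ofReal ((ρ / r) ^ ((n : ℝ) - 1) * g (ρ / r))) := by
        refine setLIntegral_mono' measurableSet_Ioo fun r hr => ?_
        have hr0 : 0 < r := hr.1
        rw [ENNReal.ofReal_mul (p := (ρ / r) ^ _) (by positivity), ← mul_assoc, ← mul_assoc,
          ← ENNReal.ofReal_mul (p := m ^ α * ρ ^ (-(n : ℝ))) (by positivity),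
          ← ENNReal.ofReal_mul (p := m ^ α * ρ ^ (-(n : ℝ)) * _) (by positivity)]
        gcongr
        have e1 : m ^ α * ρ ^ (-(n : ℝ)) * (ρ * r ^ (-2 : ℝ)) * (ρ / r) ^ ((n : ℝ) - 1) =
            m ^ α * r ^ (-(n : ℝ) - 1) := by
          rw [Real.div_rpow hρ.le hr0.le, div_eq_mul_inv, ← Real.rpow_neg hr0.le]
          have e2 : ρ ^ (-(n : ℝ)) * ρ * ρ ^ ((n : ℝ) - 1) = 1 := by
            rw [← Real.rpow_add_one hρ.ne', ← Real.rpow_add hρ]; simp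
          have e3 : r ^ (-2 : ℝ) * r ^ (-((n : ℝ) - 1)) = r ^ (-(n : ℝ) - 1) := by
            rw [← Real.rpow_add hr0]; congr 1; ring
          rw [← e3]
          linear_combination (m ^ α * r ^ (-2 : ℝ) * r ^ (-((n : ℝ) - 1))) * e2
        rw [e1]
        have e4 : r ^ (α - n - 1) = r ^ α * r ^ (-(n : ℝ) - 1) := by
          rw [← Real.rpow_add hr0]; congr 1; ring
        rw [e4]
        gcongr
        exact hr.2.le
    _ ≤ ENNReal.ofReal (m ^ α * ρ ^ (-(n : ℝ))) * (C * ENNReal.ofReal ((ρ / m) ^ (-α))) := by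
        rw [lintegral_const_mul' _ _ ENNReal.ofReal_ne_top]
        gcongr
    _ = _ := by
        rw [mul_left_comm, ← ENNReal.ofReal_mul (by positivity)]
        congr 2
        rw [Real.div_rpow hρ.le hm.le, div_eq_mul_inv, ← Real.rpow_neg hm.le, neg_neg, two_mul,
          Real.rpow_add hm, sub_eq_add_neg, Real.rpow_add hρ]
        ring

/-- Split at `r = ρ`: above it `g` is bounded by its maximum on `[0, 1]`, below it the integrated
tail applies. -/
theorem exists_setLIntegral_profile_le (hα : 0 < α) (hα2 : α ≤ n + 1) (hgc : Continuous g)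
    (htail : ∃ C : ℝ≥0, ∀ V : ℝ, 0 < V →
      ∫⁻ v in Set.Ioi V, ENNReal.ofReal (v ^ ((n : ℝ) - 1) * g v) ≤
        C * ENNReal.ofReal (V ^ (-α))) :
    ∃ K : ℝ≥0, ∀ ρ T : ℝ, 0 ≤ ρ → 0 < T →
      ∫⁻ r in Set.Ioc 0 T, ENNReal.ofReal (r ^ (α - n - 1)) * ENNReal.ofReal (g (ρ / r)) ≤
        K * ((∫⁻ r in Set.Ioc 0 (2 * T),
            (Set.Ici ρ).indicator (fun r => ENNReal.ofReal (r ^ (α - n - 1))) r) +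
          ENNReal.ofReal (T ^ (α - n)) * ENNReal.ofReal ((1 + ρ / T) ^ (-(n + α)))) := by
  obtain ⟨C, hC⟩ := htail
  obtain ⟨A, hA⟩ : ∃ A, ∀ v ∈ Set.Icc (0 : ℝ) 1, g v ≤ A := by
    obtain ⟨A, hA⟩ := isCompact_Icc.bddAbove_image (K := Set.Icc (0 : ℝ) 1) hgc.continuousOn
    exact ⟨A, fun v hv => hA ⟨v, hv, rfl⟩⟩
  set w : ℝ → ℝ≥0∞ := fun r => ENNReal.ofReal (r ^ (α - n - 1)) with hw
  have hwm : Measurable w := by fun_prop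
  -- Large enough for both cases below: `2^(1-(α-n))` when `ρ ≤ T`, and `2^(n+α)` when `ρ > T`.
  set c : ℝ≥0 := ((2 : ℝ) ^ ((n : ℝ) + 1 + α)).toNNReal with hc
  have hc' : (c : ℝ≥0∞) = ENNReal.ofReal (2 ^ ((n : ℝ) + 1 + α)) := rfl
  refine ⟨A.toNNReal + C * c, fun ρ T hρ hT => ?_⟩
  set J : ℝ≥0∞ := ∫⁻ r in Set.Ioc 0 (2 * T), (Set.Ici ρ).indicator w r with hJ
  set Q : ℝ≥0∞ := ENNReal.ofReal (T ^ (α - n)) * ENNReal.ofReal ((1 + ρ / T) ^ (-(n + α))) with hQ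
  have hsplit : ∫⁻ r in Set.Ioc 0 T, w r * ENNReal.ofReal (g (ρ / r)) ≤
      A.toNNReal * J + ∫⁻ r in Set.Ioc 0 T,
        (Set.Iio ρ).indicator (fun r => w r * ENNReal.ofReal (g (ρ / r))) r := by
    calc _ ≤ ∫⁻ r in Set.Ioc 0 T, (A.toNNReal * (Set.Ici ρ).indicator w r +
          (Set.Iio ρ).indicator (fun r => w r * ENNReal.ofReal (g (ρ / r))) r) := by
          refine setLIntegral_mono' measurableSet_Ioc fun r hr => ?_
          by_cases h : ρ ≤ r
          · simp only [Set.indicator, Set.mem_Ici, h, if_true, Set.mem_Iio, not_lt.2 h, if_false,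
              add_zero]
            rw [mul_comm]
            gcongr
            exact ENNReal.ofReal_le_ofReal
              (hA _ ⟨div_nonneg hρ hr.1.le, (div_le_one hr.1).2 h⟩)
          · simp [Set.indicator, h, not_le.1 h]
      _ = _ := by
          rw [lintegral_add_left ((hwm.indicator measurableSet_Ici).const_mul _),
            lintegral_const_mul _ (hwm.indicator measurableSet_Ici)]
      _ ≤ _ := by
          gcongr
          exact lintegral_mono_set (Set.Ioc_subset_Ioc_right (by linarith))
  have hsmall : ∫⁻ r in Set.Ioc 0 T,
      (Set.Iio ρ).indicator (fun r => w r * ENNReal.ofReal (g (ρ / r))) r ≤ C * (c * (J + Q)) := by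
    rcases hρ.eq_or_lt with rfl | hρ
    · have : ∫⁻ r in Set.Ioc 0 T,
          (Set.Iio (0 : ℝ)).indicator (fun r => w r * ENNReal.ofReal (g (0 / r))) r = 0 := by
        refine (setLIntegral_congr_fun measurableSet_Ioc fun r hr => ?_).trans lintegral_zero
        exact Set.indicator_of_notMem (s := Set.Iio 0) (not_lt.2 hr.1.le) _
      rw [this]; exact zero_le
    have hle : ∀ m, 0 < m → (Set.Ioc 0 T ∩ Set.Iio ρ : Set ℝ) ⊆ Set.Ioc 0 m →
        ∫⁻ r in Set.Ioc 0 T,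
          (Set.Iio ρ).indicator (fun r => w r * ENNReal.ofReal (g (ρ / r))) r ≤
        C * ENNReal.ofReal (m ^ (2 * α) * ρ ^ (-(n : ℝ) - α)) := by
      intro m hm hsub
      rw [lintegral_indicator measurableSet_Iio, Measure.restrict_restrict measurableSet_Iio,
        Set.inter_comm]
      refine (lintegral_mono_set hsub).trans ?_
      rw [← restrict_Ioo_eq_restrict_Ioc]
      exact setLIntegral_Ioo_profile_le hα hC hρ hm
    -- For `ρ ≤ T` take `m = ρ`: the bound `ρ^(α-n)` is absorbed by the radii in `(ρ, 2ρ]`, whence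
    -- the range `2T` in `J`. For `ρ > T` take `m = T`: the bound `T^(2α) ρ^(-n-α)` is comparable to
    -- `Q`.
    rcases le_or_gt ρ T with h | h
    · refine (hle ρ hρ fun r hr => ⟨hr.1.1, le_of_lt hr.2⟩).trans ?_
      gcongr
      have e1 : ρ ^ (2 * α) * ρ ^ (-(n : ℝ) - α) = ρ ^ (α - n) := by
        rw [← Real.rpow_add hρ]; congr 1; ring
      rw [e1]
      refine (ofReal_rpow_le_mul_setLIntegral (by linarith) hρ).trans ?_
      rw [hc']
      refine mul_le_mul' (ENNReal.ofReal_le_ofReal ?_) (le_add_right ?_)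
      · exact Real.rpow_le_rpow_of_exponent_le (by norm_num) (by linarith)
      · calc _ = ∫⁻ r in Set.Ioc ρ (2 * ρ), (Set.Ici ρ).indicator w r :=
              setLIntegral_congr_fun measurableSet_Ioc fun r hr =>
                (Set.indicator_of_mem (s := Set.Ici ρ) (f := w) hr.1.le).symm
          _ ≤ _ := lintegral_mono_set (Set.Ioc_subset_Ioc hρ.le (by linarith))
    · refine (hle T hT fun r hr => hr.1).trans ?_
      gcongr
      refine le_trans ?_ (mul_le_mul_right (le_add_left le_rfl : Q ≤ J + Q) (c : ℝ≥0∞))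
      rw [hc', hQ, ← ENNReal.ofReal_mul (by positivity), ← ENNReal.ofReal_mul (by positivity)]
      refine ENNReal.ofReal_le_ofReal ?_
      have hn : (0 : ℝ) ≤ n := by positivity
      have h2 : (1 + ρ / T) ≤ 2 * (ρ / T) := by
        have : 1 ≤ ρ / T := (one_le_div hT).2 h.le
        linarith
      have h3 : (2 * (ρ / T)) ^ (-((n : ℝ) + α)) ≤ (1 + ρ / T) ^ (-((n : ℝ) + α)) :=
        Real.rpow_le_rpow_of_nonpos (by positivity) h2 (by linarith)
      have h4 : (2 : ℝ) ^ ((n : ℝ) + 1 + α) * (T ^ (α - n) * (2 * (ρ / T)) ^ (-((n : ℝ) + α))) =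
          2 * (T ^ (2 * α) * ρ ^ (-(n : ℝ) - α)) := by
        have e1 : (2 : ℝ) ^ ((n : ℝ) + 1 + α) * 2 ^ (-((n : ℝ) + α)) = 2 := by
          rw [← Real.rpow_add (by norm_num)]
          have : (n : ℝ) + 1 + α + -((n : ℝ) + α) = 1 := by ring
          rw [this, Real.rpow_one]
        have e2 : T ^ (α - n) * (ρ / T) ^ (-((n : ℝ) + α)) =
            T ^ (2 * α) * ρ ^ (-(n : ℝ) - α) := by
          rw [Real.div_rpow hρ.le hT.le, div_eq_mul_inv, ← Real.rpow_neg hT.le, neg_neg,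
            mul_left_comm, ← Real.rpow_add hT, mul_comm]
          congr 2 <;> ring
        rw [Real.mul_rpow (by norm_num) (by positivity), ← e2]
        linear_combination (T ^ (α - n) * (ρ / T) ^ (-((n : ℝ) + α))) * e1
      have h5 : 0 ≤ T ^ (2 * α) * ρ ^ (-(n : ℝ) - α) := by positivity
      calc _ ≤ (2 : ℝ) ^ ((n : ℝ) + 1 + α) *
            (T ^ (α - n) * (2 * (ρ / T)) ^ (-((n : ℝ) + α))) := by rw [h4]; linarith
        _ ≤ _ := by gcongr
  calc _ ≤ A.toNNReal * J + C * (c * (J + Q)) := hsplit.trans (by gcongr)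
    _ ≤ A.toNNReal * (J + Q) + C * (c * (J + Q)) := by gcongr; exact le_add_right le_rfl
    _ = _ := by push_cast; ring

/-- Integrate the pointwise bound with `ρ = ‖y - x‖` against `μ`. By Tonelli the near term is
exactly a ball integral up to `2T`; the far term is governed by masses of balls of radius `T`. -/
theorem exists_heatKatoModulus_le (hα : 0 < α) (hα2 : α ≤ n + 1) (hgc : Continuous g)
    (htail : ∃ C : ℝ≥0, ∀ V : ℝ, 0 < V →
      ∫⁻ v in Set.Ioi V, ENNReal.ofReal (v ^ ((n : ℝ) - 1) * g v) ≤
        C * ENNReal.ofReal (V ^ (-α)))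
    (hpg : ∀ t : ℝ, 0 < t → ∀ x y, p t x y =
        t ^ (-((n : ℝ) / α)) * g (t ^ (-(1 / α)) * ‖y - x‖)) :
    ∃ C : ℝ≥0, ∀ (μ : Measure (EuclideanSpace ℝ (Fin n))) [SFinite μ] (T : ℝ), 0 < T →
      heatKatoModulus p μ (T ^ α) ≤ C * stableKatoModulus α μ (2 * T) := by
  obtain ⟨K, hK⟩ := exists_setLIntegral_profile_le (n := n) hα hα2 hgc htail
  obtain ⟨B, hB⟩ := exists_lintegral_one_add_norm_div_le (n := n) hα
  set d : ℝ≥0 := ((2 : ℝ) ^ (1 - (α - n))).toNNReal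
  refine ⟨α.toNNReal * (K * (1 + B * d)), fun μ _ T hT => iSup_le fun x => ?_⟩
  set w : ℝ → ℝ≥0∞ := fun r => ENNReal.ofReal (r ^ (α - n - 1)) with hw
  have hwm : Measurable w := by fun_prop
  set M := stableKatoModulus α μ (2 * T) with hM
  have hT0 : ENNReal.ofReal (T ^ (α - n)) ≠ 0 := (ENNReal.ofReal_pos.2 (by positivity)).ne'
  have hfar : ENNReal.ofReal (T ^ (α - n)) *
      ∫⁻ y, ENNReal.ofReal ((1 + ‖y - x‖ / T) ^ (-(n + α))) ∂μ ≤ B * d * M := by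
    -- The uniform bound `T^(n-α) d M` on ball masses cancels the prefactor `T^(α-n)`.
    have h1 := hB μ T hT x ((ENNReal.ofReal (T ^ (α - n)))⁻¹ * (d * M)) (fun z => by
      rw [← ENNReal.mul_le_mul_iff_right hT0 ENNReal.ofReal_ne_top, ← mul_assoc,
        ENNReal.mul_inv_cancel hT0 ENNReal.ofReal_ne_top, one_mul]
      exact ofReal_mul_measure_le_stableKatoModulus hα2 μ hT z)
    calc _ ≤ ENNReal.ofReal (T ^ (α - n)) *
          (B * ((ENNReal.ofReal (T ^ (α - n)))⁻¹ * (d * M))) := by gcongr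
      _ = ENNReal.ofReal (T ^ (α - n)) * (ENNReal.ofReal (T ^ (α - n)))⁻¹ * (B * d * M) := by ring
      _ = _ := by rw [ENNReal.mul_inv_cancel hT0 ENNReal.ofReal_ne_top, one_mul]
  have hnear : ∫⁻ y, (∫⁻ r in Set.Ioc 0 (2 * T), (Set.Ici ‖y - x‖).indicator w r) ∂μ ≤ M := by
    have hm : Measurable (fun q : EuclideanSpace ℝ (Fin n) × ℝ =>
        (Set.Ici ‖q.1 - x‖).indicator w q.2) := by
      have : (fun q : EuclideanSpace ℝ (Fin n) × ℝ => (Set.Ici ‖q.1 - x‖).indicator w q.2) =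
          {q : EuclideanSpace ℝ (Fin n) × ℝ | ‖q.1 - x‖ ≤ q.2}.indicator (fun q => w q.2) := by
        ext q; simp [Set.indicator]
      rw [this]
      exact (hwm.comp measurable_snd).indicator (measurableSet_le (by fun_prop) measurable_snd)
    rw [lintegral_lintegral_swap (f := fun y r => (Set.Ici ‖y - x‖).indicator w r) hm.aemeasurable]
    refine le_trans (lintegral_mono fun r => le_of_eq ?_) (setLIntegral_le_stableKatoModulus μ _ x)
    have : ∀ y, (Set.Ici ‖y - x‖).indicator w r = {y | ‖x - y‖ ≤ r}.indicator (fun _ => w r) y :=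
      fun y => by simp [Set.indicator, norm_sub_rev x y]
    simp_rw [this]
    rw [lintegral_indicator (measurableSet_le (by fun_prop) measurable_const), setLIntegral_const]
  rw [setLIntegral_lintegral_density_eq hα hpg μ hT x]
  have hswap : ∫⁻ r in Set.Ioc 0 T, w r * ∫⁻ y, ENNReal.ofReal (g (‖y - x‖ / r)) ∂μ =
      ∫⁻ y, (∫⁻ r in Set.Ioc 0 T, w r * ENNReal.ofReal (g (‖y - x‖ / r))) ∂μ := by
    have hm : Measurable (fun q : EuclideanSpace ℝ (Fin n) × ℝ =>
        w q.2 * ENNReal.ofReal (g (‖q.1 - x‖ / q.2))) :=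
      (hwm.comp measurable_snd).mul (hgc.measurable.comp
        (((measurable_fst.sub_const x).norm).div measurable_snd)).ennreal_ofReal
    rw [lintegral_lintegral_swap
      (f := fun y r => w r * ENNReal.ofReal (g (‖y - x‖ / r))) hm.aemeasurable]
    refine lintegral_congr fun r => ?_
    rw [lintegral_const_mul' _ _ ENNReal.ofReal_ne_top]
  rw [hswap]
  calc _ ≤ ENNReal.ofReal α * ∫⁻ y, K * ((∫⁻ r in Set.Ioc 0 (2 * T),
          (Set.Ici ‖y - x‖).indicator w r) +
          ENNReal.ofReal (T ^ (α - n)) * ENNReal.ofReal ((1 + ‖y - x‖ / T) ^ (-(n + α)))) ∂μ := by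
        gcongr with y
        exact hK _ T (norm_nonneg _) hT
    _ ≤ ENNReal.ofReal α * (K * (M + B * d * M)) := by
        rw [lintegral_const_mul' _ _ ENNReal.coe_ne_top,
          lintegral_add_right _ (by fun_prop), lintegral_const_mul' _ _ ENNReal.ofReal_ne_top]
        gcongr
    _ = _ := by
        rw [ENNReal.ofReal]; push_cast; ring

/-! ### From modulus bounds to the Kato classes -/

theorem isKatoPos_iff_tendsto_stableKatoModulus (hα : 0 < α) (hα2 : α ≤ n + 1)
    (hgc : Continuous g) (hg0 : 0 < g 0)
    (htail : ∃ C : ℝ≥0, ∀ V : ℝ, 0 < V →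
      ∫⁻ v in Set.Ioi V, ENNReal.ofReal (v ^ ((n : ℝ) - 1) * g v) ≤
        C * ENNReal.ofReal (V ^ (-α)))
    (hpg : ∀ t : ℝ, 0 < t → ∀ x y, p t x y =
        t ^ (-((n : ℝ) / α)) * g (t ^ (-(1 / α)) * ‖y - x‖))
    (μ : Measure (EuclideanSpace ℝ (Fin n))) :
    IsKatoPos p μ ↔ Tendsto (stableKatoModulus α μ) (𝓝[>] 0) (𝓝 0) := by
  have hlim : ∀ {a β : ℝ}, 0 < a → 0 < β →
      Tendsto (fun t : ℝ => a * t ^ β) (𝓝[>] 0) (𝓝[>] 0) := by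
    intro a β ha hβ
    refine tendsto_nhdsWithin_iff.2 ⟨?_, ?_⟩
    · have : Continuous fun t : ℝ => a * t ^ β :=
        continuous_const.mul (Real.continuous_rpow_const hβ.le)
      have h := (this.tendsto 0).mono_left (nhdsWithin_le_nhds (s := Set.Ioi 0))
      simpa [Real.zero_rpow hβ.ne'] using h
    · filter_upwards [self_mem_nhdsWithin] with t ht
      have : 0 < t := ht
      exact Set.mem_Ioi.2 (by positivity)
  have hsq : ∀ {F G : ℝ → ℝ≥0∞} {C : ℝ≥0}, Tendsto F (𝓝[>] 0) (𝓝 0) →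
      (∀ᶠ t in 𝓝[>] 0, G t ≤ C * F t) → Tendsto G (𝓝[>] 0) (𝓝 0) := by
    intro F G C hF h
    have h2 : Tendsto (fun t => C * F t) (𝓝[>] 0) (𝓝 0) := by
      simpa using ENNReal.Tendsto.const_mul hF (Or.inr (ENNReal.coe_ne_top (r := C)))
    exact tendsto_of_tendsto_of_tendsto_of_le_of_le' tendsto_const_nhds h2
      (.of_forall fun _ => zero_le) h
  constructor
  · intro h
    obtain ⟨ε, hε, C, hC⟩ := exists_stableKatoModulus_le hα hgc hg0 hpg
    -- The comparison is applied with `T = t/ε`, that is, with heat time `(t/ε)^α`.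
    refine hsq (C := C) (h.comp (hlim (a := (ε⁻¹) ^ α) (by positivity) hα)) ?_
    filter_upwards [self_mem_nhdsWithin] with t ht
    have ht : 0 < t := ht
    have h1 := hC μ (ε⁻¹ * t) (by positivity)
    rwa [mul_inv_cancel_left₀ hε.ne', Real.mul_rpow (by positivity) ht.le] at h1
  · intro h
    obtain ⟨C, hC⟩ := exists_heatKatoModulus_le hα hα2 hgc htail hpg
    obtain ⟨T, hT, hfin⟩ : ∃ T : ℝ, 0 < T ∧ stableKatoModulus α μ T ≠ ⊤ := by
      have h1 : ∀ᶠ t in 𝓝[>] (0 : ℝ), stableKatoModulus α μ t < ⊤ :=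
        h.eventually (gt_mem_nhds ENNReal.zero_lt_top)
      obtain ⟨T, h2, hT⟩ := (h1.and self_mem_nhdsWithin).exists
      exact ⟨T, hT, h2.ne⟩
    -- Convergence to `0` forces a finite modulus at some scale, hence the s-finiteness needed by
    -- `hC`.
    have := isLocallyFiniteMeasure_of_stableKatoModulus_ne_top hα2 hT hfin
    refine hsq (C := C) (h.comp (hlim (a := 2) (β := α⁻¹) two_pos (by positivity))) ?_
    filter_upwards [self_mem_nhdsWithin] with t ht
    have ht : 0 < t := ht
    have h1 := hC μ (t ^ α⁻¹) (by positivity)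
    rwa [Real.rpow_inv_rpow ht.le hα.ne'] at h1

theorem stableKatoModulus_mono {μ ν : Measure (EuclideanSpace ℝ (Fin n))} (h : μ ≤ ν) (T : ℝ) :
    stableKatoModulus α μ T ≤ stableKatoModulus α ν T := by
  refine iSup_mono fun x => lintegral_mono fun r => ?_
  gcongr

theorem stableKatoModulus_add_le (μ ν : Measure (EuclideanSpace ℝ (Fin n))) (T : ℝ) :
    stableKatoModulus α (μ + ν) T ≤ stableKatoModulus α μ T + stableKatoModulus α ν T := by
  refine stableKatoModulus_le fun x => ?_
  have hm : Measurable fun r : ℝ => ENNReal.ofReal (r ^ (α - n - 1)) * μ {y | ‖x - y‖ ≤ r} := by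
    have : Monotone fun r : ℝ => μ {y | ‖x - y‖ ≤ r} := fun a b hab =>
      measure_mono fun y (hy : ‖x - y‖ ≤ a) => hy.trans hab
    exact (by fun_prop : Measurable fun r : ℝ => ENNReal.ofReal (r ^ (α - n - 1))).mul
      this.measurable
  simp only [Measure.add_apply, mul_add]
  rw [lintegral_add_left hm]
  exact add_le_add (setLIntegral_le_stableKatoModulus μ T x)
    (setLIntegral_le_stableKatoModulus ν T x)

/-- The modulus is monotone and subadditive in the measure, so it vanishes in the limit for the sum
exactly when it does for both parts. -/
theorem mem_stableKatoClass_iff (ϖ : SignedBorelMeasure n) :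
    ϖ ∈ stableKatoClass n α ↔ Tendsto (stableKatoModulus α ϖ.pos) (𝓝[>] 0) (𝓝 0) ∧
      Tendsto (stableKatoModulus α ϖ.neg) (𝓝[>] 0) (𝓝 0) := by
  change Tendsto (stableKatoModulus α (ϖ.pos + ϖ.neg)) (𝓝[>] 0) (𝓝 0) ↔ _
  constructor
  · intro h
    exact ⟨tendsto_of_tendsto_of_tendsto_of_le_of_le tendsto_const_nhds h (fun _ => zero_le)
        (stableKatoModulus_mono (Measure.le_add_right le_rfl)),
      tendsto_of_tendsto_of_tendsto_of_le_of_le tendsto_const_nhds h (fun _ => zero_le)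
        (stableKatoModulus_mono (Measure.le_add_left le_rfl))⟩
  · rintro ⟨h1, h2⟩
    refine tendsto_of_tendsto_of_tendsto_of_le_of_le tendsto_const_nhds ?_ (fun _ => zero_le)
      (stableKatoModulus_add_le ϖ.pos ϖ.neg)
    simpa using h1.add h2

end

theorem mainTheorem5 {Ω : Type*} [MeasurableSpace Ω] (P : Measure Ω) [IsProbabilityMeasure P]
    (n : ℕ) (hn : 1 ≤ n) (α : ℝ) (hα0 : 0 < α) (hα2 : α < 2)
    (X : ℝ≥0 → Ω → EuclideanSpace ℝ (Fin n)) (hX : IsSymmetricStableProcess α X P)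
    (p : ℝ → EuclideanSpace ℝ (Fin n) → EuclideanSpace ℝ (Fin n) → ℝ)
    (hp : IsTransitionDensity X P p) (ϖ : SignedBorelMeasure n) :
    IsKato p ϖ ↔ ϖ ∈ stableKatoClass n α := by
  obtain ⟨g, hgc, -, hg0, htail, hpg⟩ := hp.exists_radial_profile hn hα0 hX
  have hαn : α ≤ n + 1 := by
    have : (1 : ℝ) ≤ n := by exact_mod_cast hn
    linarith
  rw [mem_stableKatoClass_iff, IsKato,
    isKatoPos_iff_tendsto_stableKatoModulus hα0 hαn hgc hg0 htail hpg,
    isKatoPos_iff_tendsto_stableKatoModulus hα0 hαn hgc hg0 htail hpg]
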